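/- Let $A$ be a quantum system of finite dimension $d_A\ge 1$ and $Y$ a classical system with a finite nonempty alphabet $\mathcal Y$. A classical-quantum (c-q) state of $AY$ is a density matrix of the form $\rho_{AY}=\sum_{y\in\mathcal Y} r_Y(y)\,\rho_A^y\otimes|y\rangle\langle y|_Y$, where $r_Y$ is a probability distribution on $\mathcal Y$ and each $\rho_A^y$ is a density matrix of $A$. For $\alpha\in(0,1)$ let $$H_\alpha(A|Y)_\rho:=\frac{\alpha}{1-\alpha}\log\operatorname{Tr}\Big(\big(\operatorname{Tr}_A\rho_{AY}^\alpha\big)^{1/\alpha}\Big),$$ and for $\alpha=0$ let $H_0(A|Y)_\rho:=\lim_{\alpha\to0^+}H_\alpha(A|Y)_\rho=\log\lambda_{\max}(\operatorname{Tr}_A\Pi_\rho)$, where $\Pi_\rho$ is the orthogonal projection onto the support of $\rho_{AY}$ and $\lambda_{\max}$ denotes the largest eigenvalue. For $M$ acting on the Hilbert space of $AY$, let $\|M\|_1:=\operatorname{Tr}\sqrt{M^\dagger M}$. Let $\alpha\in[0,1)$ and $\epsilon\in(0,1-\frac1{d_A}]$, and put $$\gamma(\alpha,\epsilon,d_A):=\frac{1}{1-\alpha}\log\Big((1-\epsilon)^\alpha+(d_A-1)^{1-\alpha}\epsilon^\alpha\Big).$$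 Then for all c-q states $\rho_{AY},\sigma_{AY}$ with $\frac12\|\rho_{AY}-\sigma_{AY}\|_1\le\epsilon$, $$\big|H_\alpha(A|Y)_\rho-H_\alpha(A|Y)_\sigma\big|\le\gamma(\alpha,\epsilon,d_A).$$ Moreover, the inequality is tight: $$\sup_{\rho_{AY},\sigma_{AY}}\frac{\big|H_\alpha(A|Y)_\rho-H_\alpha(A|Y)_\sigma\big|}{\gamma(\alpha,\epsilon,d_A)}=1,$$ where the supremum is over all pairs of c-q states of $AY$ with $\frac12\|\rho_{AY}-\sigma_{AY}\|_1\le\epsilon$. -/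

import Mathlib

open scoped Kronecker ComplexOrder

noncomputable section

namespace CQEntropy

variable {n A B : Type*} [Fintype n] [DecidableEq n] [Fintype A] [DecidableEq A]
  [Fintype B] [DecidableEq B]

/-- A density matrix: a positive semidefinite matrix of unit trace. -/
def IsState (ρ : Matrix n n ℂ) : Prop :=
  ρ.PosSemidef ∧ ρ.trace = 1

/-- A classical-quantum state of `A` (quantum) and `B` (classical), that is,
`∑ y, r(y) ρ^y ⊗ |y⟩⟨y|` with `r` a probability distribution on `B` and each `ρ^y` a
density matrix of the system `A`. -/
def IsCQState (ρ : Matrix (A × B) (A × B) ℂ) : Prop :=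
  ∃ (r : B → ℝ) (τ : B → Matrix A A ℂ),
    (∀ y, 0 ≤ r y) ∧ ∑ y, r y = 1 ∧ (∀ y, IsState (τ y)) ∧
      ρ = ∑ y, (r y : ℂ) • (τ y ⊗ₖ Matrix.single y y (1 : ℂ))

/-- The trace norm `‖M‖₁ = Tr √(M† M)`. -/
def traceNorm (M : Matrix n n ℂ) : ℝ :=
  (cfc Real.sqrt (M.conjTranspose * M)).trace.re

/-- The trace distance `½ ‖ρ - σ‖₁`. -/
def traceDist (ρ σ : Matrix n n ℂ) : ℝ :=
  (1 / 2) * traceNorm (ρ - σ)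

/-- The power `M ^ s`, `0 ≤ s`, of a positive semidefinite matrix, through the spectral
calculus. The zero eigenvalue is sent to zero for every `s`, so `M ^ 0` is the orthogonal
projection onto the support of `M`. -/
def psdPow (M : Matrix n n ℂ) (s : ℝ) : Matrix n n ℂ :=
  cfc (fun x : ℝ => if x = 0 then 0 else x ^ s) M

/-- The partial trace over the first system. -/
def partialTraceLeft (M : Matrix (A × B) (A × B) ℂ) : Matrix B B ℂ :=
  Matrix.of fun i j => ∑ a, M (a, i) (a, j)

/-- The (Petz) conditional Rényi entropy of order `α` of the first system given the second.
For `0 < α < 1` it is `α / (1 - α) * log Tr ((Tr_A ρ ^ α) ^ (1 / α))`, with the natural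
logarithm. At `α = 0` this expression is read as its limit for `α → 0⁺`. Since
`Tr (X ^ (1 / α)) ^ α` is the Schatten norm of order `1 / α`, the limit is the logarithm of
the largest eigenvalue of `Tr_A ρ ^ 0`, where `ρ ^ 0` is the support projection. -/
def condRenyi (α : ℝ) (ρ : Matrix (A × B) (A × B) ℂ) : ℝ :=
  if α = 0 then
    Real.log (sSup (spectrum ℝ (partialTraceLeft (psdPow ρ 0))))
  else
    α / (1 - α) *
      Real.log (psdPow (partialTraceLeft (psdPow ρ α)) (1 / α)).trace.re

/-- The bound `γ(α, ε, d) = 1 / (1 - α) * log ((1 - ε) ^ α + (d - 1) ^ (1 - α) * ε ^ α)`. -/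
def gammaBound (α ε : ℝ) (d : ℕ) : ℝ :=
  1 / (1 - α) * Real.log ((1 - ε) ^ α + ((d : ℝ) - 1) ^ (1 - α) * ε ^ α)

end CQEntropy

end

namespace CQEntropy

/-! ### The power functional `(∑ xᵢ ^ α) ^ (1 / α)` for `0 < α < 1` -/

/-! Let `F` be `powerNorm α`. For `0 < α < 1` the entropy is `α / (1 - α)` times the logarithm of `∑
y, F (d y)`, where `d y` is the spectrum of the block at `y`, weight included. With `n = d_A - 1`
and `C = ((1 - ε) ^ α + n ^ (1 - α) * ε ^ α) ^ (1 / α)`, it suffices to show that the sum of one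
state is at most `C` times that of the other.

Reduction to vectors (`exists_pinching`, `exists_smoothing`): replace the spectrum of each block of
`ρ` by its diagonal in an eigenbasis of the matching block of `σ`. This doubly stochastic averaging
can only raise `F`, and the total variation distance to the spectrum of `σ` stays within the trace
distance.

Vector bound (`sum_powerNorm_le`): `(X, R) ↦ (X ^ α + n ^ (1 - α) * R ^ α) ^ (1 / α)` is concave and
homogeneous of degree one, so it lies below the linear form `N₁ X + N₂ R` given by its gradient at
`(1 - ε, ε)`. This yields, for each `y`, an estimate of `F p` that is affine in `F q`, `∑ p`, `∑ q`
and the overlap `∑ min p q` (`powerNorm_le_min`). Only after summing over `y` are normalization and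
the distance bound used: the total overlap is at least `1 - ε`, and `N₁ (1 - ε) + N₂ ε = C`.

At `α = 0` both entropies lie in `[0, log d_A]` and the bound is `log d_A`. Equality holds for the
spectrum `(1 - ε, ε / n, …, ε / n)` against a pure state, both at one classical value. -/

/-- The reverse quasi-norm `(∑ xᵢ ^ α) ^ (1 / α)`. -/
noncomputable def powerNorm {ι : Type*} [Fintype ι] (α : ℝ) (x : ι → ℝ) : ℝ :=
  (∑ i, x i ^ α) ^ (1 / α)

section PowerNorm

variable {ι : Type*} [Fintype ι] {α : ℝ}

lemma powerNorm_nonneg {x : ι → ℝ} (hx : ∀ i, 0 ≤ x i) : 0 ≤ powerNorm α x :=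
  Real.rpow_nonneg (Finset.sum_nonneg fun i _ => Real.rpow_nonneg (hx i) _) _

lemma powerNorm_rpow (hα : 0 < α) {x : ι → ℝ} (hx : ∀ i, 0 ≤ x i) :
    powerNorm α x ^ α = ∑ i, x i ^ α := by
  rw [powerNorm, ← Real.rpow_mul (Finset.sum_nonneg fun i _ => Real.rpow_nonneg (hx i) _),
    one_div_mul_cancel hα.ne', Real.rpow_one]

lemma powerNorm_le_iff (hα : 0 < α) {x : ι → ℝ} (hx : ∀ i, 0 ≤ x i) {c : ℝ} (hc : 0 ≤ c) :
    powerNorm α x ≤ c ↔ ∑ i, x i ^ α ≤ c ^ α := by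
  rw [← powerNorm_rpow hα hx, Real.rpow_le_rpow_iff (powerNorm_nonneg hx) hc hα]

lemma le_powerNorm_iff (hα : 0 < α) {x : ι → ℝ} (hx : ∀ i, 0 ≤ x i) {c : ℝ} (hc : 0 ≤ c) :
    c ≤ powerNorm α x ↔ c ^ α ≤ ∑ i, x i ^ α := by
  rw [← powerNorm_rpow hα hx, Real.rpow_le_rpow_iff hc (powerNorm_nonneg hx) hα]

lemma powerNorm_mono (hα : 0 < α) {x y : ι → ℝ} (hx : ∀ i, 0 ≤ x i) (hxy : ∀ i, x i ≤ y i) :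
    powerNorm α x ≤ powerNorm α y :=
  (powerNorm_le_iff hα hx (powerNorm_nonneg fun i => (hx i).trans (hxy i))).2 <| by
    rw [powerNorm_rpow hα fun i => (hx i).trans (hxy i)]
    exact Finset.sum_le_sum fun i _ => Real.rpow_le_rpow (hx i) (hxy i) hα.le

lemma powerNorm_smul (hα : 0 < α) {c : ℝ} (hc : 0 ≤ c) {x : ι → ℝ} (hx : ∀ i, 0 ≤ x i) :
    powerNorm α (c • x) = c * powerNorm α x := by
  have h : ∑ i, (c • x) i ^ α = c ^ α * ∑ i, x i ^ α := by
    rw [Finset.mul_sum]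
    exact Finset.sum_congr rfl fun i _ => by simp [Real.mul_rpow hc (hx i)]
  rw [powerNorm, h, Real.mul_rpow (Real.rpow_nonneg hc _)
    (Finset.sum_nonneg fun i _ => Real.rpow_nonneg (hx i) _), ← Real.rpow_mul hc,
    mul_one_div_cancel hα.ne', Real.rpow_one, powerNorm]

/-- The reverse Minkowski inequality. -/
lemma powerNorm_add_le (hα : 0 < α) (hα' : α ≤ 1) {x y : ι → ℝ} (hx : ∀ i, 0 ≤ x i)
    (hy : ∀ i, 0 ≤ y i) : powerNorm α x + powerNorm α y ≤ powerNorm α (x + y) := by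
  have hxy : ∀ i, 0 ≤ (x + y) i := fun i => add_nonneg (hx i) (hy i)
  rcases (powerNorm_nonneg (α := α) hx).eq_or_lt with ha | ha
  · rw [← ha, zero_add]
    exact powerNorm_mono hα hy fun i => by simpa using hx i
  rcases (powerNorm_nonneg (α := α) hy).eq_or_lt with hb | hb
  · rw [← hb, add_zero]
    exact powerNorm_mono hα hx fun i => by simpa using hy i
  rw [le_powerNorm_iff hα hxy (by positivity)]
  have hxs := powerNorm_rpow hα hx
  have hys := powerNorm_rpow hα hy
  set a := powerNorm α x
  set b := powerNorm α y
  -- Normalize both vectors to have `powerNorm` one; then `(x + y) / (a + b)` is their convex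
  -- combination with weights `a / (a + b)` and `b / (a + b)`, and `t ↦ t ^ α` is concave.
  have key : ∀ i, (a + b) ^ α * (a / (a + b) * (x i ^ α / a ^ α) + b / (a + b) * (y i ^ α / b ^ α))
      ≤ (x + y) i ^ α := fun i => by
    have h := (Real.concaveOn_rpow hα.le hα').2
      (show x i / a ∈ Set.Ici 0 from div_nonneg (hx i) ha.le)
      (show y i / b ∈ Set.Ici 0 from div_nonneg (hy i) hb.le)
      (show 0 ≤ a / (a + b) by positivity) (show 0 ≤ b / (a + b) by positivity) (by field_simp)
    simp only [smul_eq_mul] at h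
    rw [Real.div_rpow (hx i) ha.le, Real.div_rpow (hy i) hb.le] at h
    refine (mul_le_mul_of_nonneg_left h (by positivity)).trans_eq ?_
    rw [← Real.mul_rpow (by positivity) (by have := hx i; have := hy i; positivity)]
    congr 1
    simp only [Pi.add_apply]
    field_simp
  refine le_trans (le_of_eq ?_) (Finset.sum_le_sum fun i _ => key i)
  have ha' : a ^ α ≠ 0 := (Real.rpow_pos_of_pos ha _).ne'
  have hb' : b ^ α ≠ 0 := (Real.rpow_pos_of_pos hb _).ne'
  rw [← Finset.mul_sum, Finset.sum_add_distrib, ← Finset.mul_sum, ← Finset.mul_sum,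
    ← Finset.sum_div, ← Finset.sum_div, ← hxs, ← hys, div_self ha', div_self hb']
  field_simp

lemma concaveOn_powerNorm (hα : 0 < α) (hα' : α ≤ 1) :
    ConcaveOn ℝ (Set.Ici (0 : ι → ℝ)) (powerNorm α) := by
  refine ⟨convex_Ici 0, fun x hx y hy a b ha hb _ => ?_⟩
  rw [smul_eq_mul, smul_eq_mul, ← powerNorm_smul hα ha hx, ← powerNorm_smul hα hb hy]
  exact powerNorm_add_le hα hα' (fun i => mul_nonneg ha (hx i)) fun i => mul_nonneg hb (hy i)

lemma sum_rpow_le_rpow_sum {ι : Type*} (hα : 0 < α) (hα' : α ≤ 1) (s : Finset ι) {x : ι → ℝ}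
    (hx : ∀ i, 0 ≤ x i) : (∑ i ∈ s, x i) ^ α ≤ ∑ i ∈ s, x i ^ α := by
  classical
  induction s using Finset.induction_on with
  | empty => simp [Real.zero_rpow hα.ne']
  | insert i s hi ih =>
    rw [Finset.sum_insert hi, Finset.sum_insert hi]
    exact (Real.rpow_add_le_add_rpow (hx i) (Finset.sum_nonneg fun i _ => hx i) hα.le hα').trans
      (by gcongr)

lemma sum_le_powerNorm (hα : 0 < α) (hα' : α ≤ 1) {x : ι → ℝ} (hx : ∀ i, 0 ≤ x i) :
    ∑ i, x i ≤ powerNorm α x :=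
  (le_powerNorm_iff hα hx (Finset.sum_nonneg fun i _ => hx i)).2
    (sum_rpow_le_rpow_sum hα hα' _ hx)

/-- Power mean inequality: for a given total, the sum of powers is largest when the mass is spread
evenly. -/
lemma sum_rpow_le_card_mul {ι : Type*} (hα : 0 < α) (hα' : α ≤ 1) (s : Finset ι) {x : ι → ℝ}
    (hx : ∀ i, 0 ≤ x i) {n : ℝ} (hs : (s.card : ℝ) ≤ n) :
    ∑ i ∈ s, x i ^ α ≤ n ^ (1 - α) * (∑ i ∈ s, x i) ^ α := by
  have h0 : 0 ≤ ∑ i ∈ s, x i ^ α := Finset.sum_nonneg fun i _ => Real.rpow_nonneg (hx i) _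
  have h := Real.rpow_sum_le_const_mul_sum_rpow_of_nonneg s (f := fun i => x i ^ α)
    (p := 1 / α) (by rw [one_le_div hα]; exact hα') fun i _ => Real.rpow_nonneg (hx i) _
  have h1 : ∀ i, (x i ^ α) ^ (1 / α) = x i := fun i => by
    rw [← Real.rpow_mul (hx i), mul_one_div_cancel hα.ne', Real.rpow_one]
  simp only [h1] at h
  have h2 := Real.rpow_le_rpow (Real.rpow_nonneg h0 _) h hα.le
  rw [← Real.rpow_mul h0, one_div_mul_cancel hα.ne', Real.rpow_one,
    Real.mul_rpow (by positivity) (Finset.sum_nonneg fun i _ => hx i),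
    ← Real.rpow_mul (by positivity), sub_mul, one_div_mul_cancel hα.ne', one_mul] at h2
  refine h2.trans ?_
  gcongr
  · exact Real.rpow_nonneg (Finset.sum_nonneg fun i _ => hx i) _

/-! ### Tangent inequalities -/

lemma rpow_le_tangent (hα : 0 < α) (hα' : α ≤ 1) {t s : ℝ} (ht : 0 ≤ t) (hs : 0 < s) :
    t ^ α ≤ α * s ^ (α - 1) * t + (1 - α) * s ^ α := by
  have h := rpow_one_add_le_one_add_mul_self (s := t / s - 1) (by linarith [div_nonneg ht hs.le])
    hα.le hα'
  rw [add_sub_cancel, Real.div_rpow ht hs.le, div_le_iff₀ (Real.rpow_pos_of_pos hs _)] at h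
  refine h.trans_eq ?_
  rw [Real.rpow_sub_one hs.ne']
  field_simp
  ring

/-- The tangent plane to `(X, R) ↦ (X ^ α + n ^ (1 - α) * R ^ α) ^ (1 / α)` at `(x, n * z)`,
where `C` is the value at that point, lies above the function. -/
lemma rpow_add_rpow_le_tangent (hα : 0 < α) (hα' : α ≤ 1) {n x z C : ℝ} (hn : 0 < n) (hx : 0 < x)
    (hz : 0 < z) (hC : 0 < C) (hCα : C ^ α = x ^ α + n * z ^ α) {X R : ℝ} (hX : 0 ≤ X)
    (hR : 0 ≤ R) :
    X ^ α + n ^ (1 - α) * R ^ α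
      ≤ (C ^ (1 - α) * x ^ (α - 1) * X + C ^ (1 - α) * z ^ (α - 1) * R) ^ α := by
  set G := C ^ (1 - α) * x ^ (α - 1) * X + C ^ (1 - α) * z ^ (α - 1) * R with hG
  have hG0 : 0 ≤ G := by positivity
  rcases hG0.eq_or_lt with h0 | hpos
  · have h1 : 0 ≤ C ^ (1 - α) * x ^ (α - 1) * X := by positivity
    have h2 : 0 ≤ C ^ (1 - α) * z ^ (α - 1) * R := by positivity
    have h3 : C ^ (1 - α) * x ^ (α - 1) * X = 0 := by linarith
    have h4 : C ^ (1 - α) * z ^ (α - 1) * R = 0 := by linarith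
    have hXz : X = 0 := (mul_eq_zero.1 h3).resolve_left (by positivity)
    have hRz : R = 0 := (mul_eq_zero.1 h4).resolve_left (by positivity)
    rw [← h0, hXz, hRz, Real.zero_rpow hα.ne']
    simp
  -- By homogeneity the gradient is constant along the ray through `(x, n * z)`. Rescaling by `l`
  -- makes the value there equal to `G`, so the one-variable tangents at `l * x` and `l * (n * z)`
  -- add up to `α * G ^ α + (1 - α) * G ^ α`.
  set l := G / C with hl
  have hl0 : 0 < l := by positivity
  have hGl : G = l * C := by rw [hl]; field_simp
  have t1 := rpow_le_tangent hα hα' hX (mul_pos hl0 hx)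
  have t2 := rpow_le_tangent hα hα' hR (mul_pos hl0 (mul_pos hn hz))
  rw [Real.mul_rpow hl0.le hx.le, Real.mul_rpow hl0.le hx.le] at t1
  rw [Real.mul_rpow hl0.le (mul_pos hn hz).le, Real.mul_rpow hl0.le (mul_pos hn hz).le,
    Real.mul_rpow hn.le hz.le, Real.mul_rpow hn.le hz.le] at t2
  have e1 : n ^ (1 - α) * n ^ (α - 1) = 1 := by
    rw [← Real.rpow_add hn]; simp
  have e2 : n ^ (1 - α) * n ^ α = n := by
    rw [← Real.rpow_add hn]; simp
  have e3 : C ^ (1 - α) * C ^ (α - 1) = 1 := by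
    rw [← Real.rpow_add hC]; simp
  have e4 : l ^ (α - 1) * l = l ^ α := by
    rw [Real.rpow_sub_one hl0.ne']; field_simp
  have e5 : C ^ (α - 1) * C = C ^ α := by
    rw [Real.rpow_sub_one hC.ne']; field_simp
  calc X ^ α + n ^ (1 - α) * R ^ α
      ≤ (α * (l ^ (α - 1) * x ^ (α - 1)) * X + (1 - α) * (l ^ α * x ^ α)) + n ^ (1 - α) *
        (α * (l ^ (α - 1) * (n ^ (α - 1) * z ^ (α - 1))) * R
          + (1 - α) * (l ^ α * (n ^ α * z ^ α))) := by gcongr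
    _ = α * l ^ (α - 1) * (x ^ (α - 1) * X + z ^ (α - 1) * R * (n ^ (1 - α) * n ^ (α - 1)))
        + (1 - α) * l ^ α * (x ^ α + (n ^ (1 - α) * n ^ α) * z ^ α) := by ring
    _ = α * l ^ (α - 1) * (C ^ (α - 1) * G) + (1 - α) * l ^ α * C ^ α := by
        rw [e1, e2, ← hCα, hG]
        linear_combination (-α * l ^ (α - 1) * (x ^ (α - 1) * X + z ^ (α - 1) * R)) * e3
    _ = G ^ α := by
        rw [hGl, Real.mul_rpow hl0.le hC.le]
        linear_combination (α * C ^ (α - 1) * C) * e4 + α * l ^ α * e5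

/-! ### Continuity bound for nonnegative vectors -/

variable {C N₁ N₂ : ℝ}

/-- The comparison of `powerNorm` at `p` and at a restriction `w` of `p` to a nonempty set. -/
lemma powerNorm_le_of_restrict (hα : 0 < α) (hα' : α ≤ 1) (h1 : 0 ≤ N₁) (h12 : N₁ ≤ N₂)
    (hC : N₁ ≤ C)
    (hT : ∀ X R : ℝ, 0 ≤ X → 0 ≤ R →
      X ^ α + ((Fintype.card ι : ℝ) - 1) ^ (1 - α) * R ^ α ≤ (N₁ * X + N₂ * R) ^ α)
    {p w : ι → ℝ} (hp : ∀ i, 0 ≤ p i) (hw : ∀ i, w i = 0 ∨ w i = p i) (hne : ∃ i, w i = p i) :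
    powerNorm α p ≤ C * (powerNorm α w - ∑ i, w i) + N₁ * ∑ i, w i + N₂ * ∑ i, (p i - w i) := by
  classical
  have hw0 : ∀ i, 0 ≤ w i := fun i => by rcases hw i with h | h <;> simp [h, hp i]
  have hpw : ∀ i, 0 ≤ p i - w i := fun i => by rcases hw i with h | h <;> simp [h, hp i]
  obtain ⟨i₀, hi₀⟩ := hne
  have hR := Finset.sum_nonneg fun i (_ : i ∈ Finset.univ) => hpw i
  have hX := powerNorm_nonneg (α := α) hw0
  -- At each index one of `w i` and `p i - w i` vanishes. The index `i₀` contributes nothing to the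
  -- second sum, which leaves `card ι - 1` terms, the constant in `hT`.
  have hsplit : ∑ i, p i ^ α = ∑ i, w i ^ α + ∑ i ∈ Finset.univ.erase i₀, (p i - w i) ^ α := by
    have h : ∑ i ∈ Finset.univ.erase i₀, (p i - w i) ^ α = ∑ i, (p i - w i) ^ α :=
      Finset.sum_erase _ (by rw [hi₀, sub_self, Real.zero_rpow hα.ne'])
    rw [h, ← Finset.sum_add_distrib]
    refine Finset.sum_congr rfl fun i _ => ?_
    rcases hw i with h | h <;> simp [h, Real.zero_rpow hα.ne']
  have hR' : ∑ i ∈ Finset.univ.erase i₀, (p i - w i) = ∑ i, (p i - w i) :=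
    Finset.sum_erase _ (by rw [hi₀, sub_self])
  have hcard : (((Finset.univ.erase i₀).card : ℕ) : ℝ) ≤ (Fintype.card ι : ℝ) - 1 := by
    rw [Finset.card_erase_of_mem (Finset.mem_univ _), Finset.card_univ,
      Nat.cast_sub (Fintype.card_pos_iff.2 ⟨i₀⟩), Nat.cast_one]
  have hle : powerNorm α p ≤ N₁ * powerNorm α w + N₂ * ∑ i, (p i - w i) := by
    rw [powerNorm_le_iff hα hp
      (add_nonneg (mul_nonneg h1 hX) (mul_nonneg (h1.trans h12) hR)), hsplit]
    refine le_trans ?_ (hT _ _ hX hR)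
    rw [powerNorm_rpow hα hw0]
    have h := sum_rpow_le_card_mul hα hα' (Finset.univ.erase i₀) hpw hcard
    rw [hR'] at h
    gcongr
  -- Allows the excess `powerNorm α w - ∑ i, w i` to carry the coefficient `C` instead of `N₁`.
  have h3 := mul_nonneg (sub_nonneg.2 hC) (sub_nonneg.2 (sum_le_powerNorm hα hα' hw0))
  linarith

/-- The right-hand side is concave in `w`, so on the box `0 ≤ w ≤ p` it is bounded below by its
value at some vertex, where each `w i` is `0` or `p i`; vertices are covered by
`powerNorm_le_of_restrict`. -/
lemma powerNorm_le_of_le [Nonempty ι] (hα : 0 < α) (hα' : α ≤ 1) (h1 : 0 ≤ N₁) (h12 : N₁ ≤ N₂)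
    (hC : N₁ ≤ C)
    (hT : ∀ X R : ℝ, 0 ≤ X → 0 ≤ R →
      X ^ α + ((Fintype.card ι : ℝ) - 1) ^ (1 - α) * R ^ α ≤ (N₁ * X + N₂ * R) ^ α)
    {p w : ι → ℝ} (hw : ∀ i, 0 ≤ w i) (hwp : ∀ i, w i ≤ p i) :
    powerNorm α p ≤ C * (powerNorm α w - ∑ i, w i) + N₁ * ∑ i, w i + N₂ * ∑ i, (p i - w i) := by
  classical
  have hp : ∀ i, 0 ≤ p i := fun i => (hw i).trans (hwp i)
  have hC0 : 0 ≤ C := h1.trans hC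
  have hconc : ConcaveOn ℝ (Set.Ici (0 : ι → ℝ))
      (fun w => C * powerNorm α w - (C - N₁ + N₂) * ∑ i, w i) := by
    refine ((concaveOn_powerNorm hα hα').smul hC0).sub (g := fun w : ι → ℝ => (C - N₁ + N₂) * ∑ i, w i)
      ⟨convex_Ici 0, fun x _ y _ a b _ _ _ => le_of_eq ?_⟩
    simp only [Pi.add_apply, Pi.smul_apply, smul_eq_mul, Finset.sum_add_distrib,
      ← Finset.mul_sum]
    ring
  have hmem : w ∈ convexHull ℝ (Set.univ.pi fun i => ({0, p i} : Set ℝ)) := by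
    rw [convexHull_pi]
    intro i _
    change w i ∈ convexHull ℝ {0, p i}
    rw [convexHull_pair, segment_eq_Icc (hp i)]
    exact ⟨hw i, hwp i⟩
  obtain ⟨v, hv, hvw⟩ := hconc.exists_le_of_mem_convexHull (by
    intro v hv i
    rcases hv i (Set.mem_univ i) with h | h
    · simp [h]
    · simpa [Set.mem_singleton_iff.1 h] using hp i) hmem
  have hv' : ∀ i, v i = 0 ∨ v i = p i := fun i => hv i (Set.mem_univ i)
  have hgoal : powerNorm α p
      ≤ C * (powerNorm α v - ∑ i, v i) + N₁ * ∑ i, v i + N₂ * ∑ i, (p i - v i) := by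
    by_cases hne : ∃ i, v i = p i
    · exact powerNorm_le_of_restrict hα hα' h1 h12 hC hT hp hv' hne
    have hv0 : v = 0 := funext fun i => (hv' i).resolve_right fun h => hne ⟨i, h⟩
    obtain ⟨i₀⟩ := ‹Nonempty ι›
    -- The zero vertex may be no restriction to a nonempty set. Keeping a single coordinate gives
    -- zero excess and the bound `N₁ * p i₀ + N₂ * (∑ p - p i₀)`, at most `N₂ * ∑ p` since `N₁ ≤
    -- N₂`.
    have h := powerNorm_le_of_restrict (w := Pi.single i₀ (p i₀)) hα hα' h1 h12 le_rfl hT hp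
      (fun i => by
        rcases eq_or_ne i i₀ with rfl | hi
        · simp
        · simp [hi]) ⟨i₀, by simp⟩
    have hs : powerNorm α (Pi.single i₀ (p i₀)) = p i₀ := by
      rw [powerNorm, Finset.sum_eq_single i₀, Pi.single_eq_same, ← Real.rpow_mul (hp i₀),
        mul_one_div_cancel hα.ne', Real.rpow_one]
      · intro i _ hi
        rw [Pi.single_eq_of_ne hi, Real.zero_rpow hα.ne']
      · simp
    have h0 : powerNorm α (0 : ι → ℝ) = 0 := by
      simp [powerNorm, Real.zero_rpow hα.ne', hα.ne']
    rw [hs, Finset.sum_pi_single', Finset.sum_sub_distrib, Finset.sum_pi_single'] at h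
    simp only [Finset.mem_univ, if_true] at h
    rw [hv0, h0]
    simp only [Pi.zero_apply, Finset.sum_const_zero, sub_zero, mul_zero, zero_add]
    have := mul_le_mul_of_nonneg_right h12 (hp i₀)
    linarith
  simp only [Finset.sum_sub_distrib] at hgoal ⊢
  linarith

/-- Take `w = min p q` in `powerNorm_le_of_le`. By superadditivity the excess of `powerNorm` over
the plain sum does not decrease from `min p q` to `q`. -/
lemma powerNorm_le_min [Nonempty ι] (hα : 0 < α) (hα' : α ≤ 1) (h1 : 0 ≤ N₁) (h12 : N₁ ≤ N₂)
    (hC : N₁ ≤ C)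
    (hT : ∀ X R : ℝ, 0 ≤ X → 0 ≤ R →
      X ^ α + ((Fintype.card ι : ℝ) - 1) ^ (1 - α) * R ^ α ≤ (N₁ * X + N₂ * R) ^ α)
    {p q : ι → ℝ} (hp : ∀ i, 0 ≤ p i) (hq : ∀ i, 0 ≤ q i) :
    powerNorm α p ≤ C * (powerNorm α q - ∑ i, q i) + N₁ * ∑ i, min (p i) (q i)
      + N₂ * (∑ i, p i - ∑ i, min (p i) (q i)) := by
  have hm : ∀ i, 0 ≤ min (p i) (q i) := fun i => le_min (hp i) (hq i)
  have h := powerNorm_le_of_le hα hα' h1 h12 hC hT hm (fun i => min_le_left (p i) (q i))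
  have hd : ∀ i, 0 ≤ q i - min (p i) (q i) := fun i => sub_nonneg.2 (min_le_right _ _)
  have h2 := powerNorm_add_le hα hα' hm hd
  have h3 := sum_le_powerNorm hα hα' hd
  have h4 : (fun i => min (p i) (q i)) + (fun i => q i - min (p i) (q i)) = q := by
    ext i; simp
  rw [h4] at h2
  rw [Finset.sum_sub_distrib] at h3 h
  have h5 := mul_le_mul_of_nonneg_left (show powerNorm α (fun i => min (p i) (q i))
    - ∑ i, min (p i) (q i) ≤ powerNorm α q - ∑ i, q i by linarith) (h1.trans hC)
  linarith

/-- The continuity bound for `∑ y, (∑ a, p y a ^ α) ^ (1 / α)` in total variation distance. -/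
theorem sum_powerNorm_le {κ : Type*} [Fintype κ] (hα : 0 < α) (hα' : α < 1)
    {ε : ℝ} (hε : 0 < ε) (hε' : ε ≤ 1 - 1 / (Fintype.card ι : ℝ)) {p q : κ → ι → ℝ}
    (hp : ∀ y i, 0 ≤ p y i) (hq : ∀ y i, 0 ≤ q y i) (hps : ∑ y, ∑ i, p y i = 1)
    (hqs : ∑ y, ∑ i, q y i = 1) (hpq : ∑ y, ∑ i, |p y i - q y i| ≤ 2 * ε) :
    ∑ y, powerNorm α (p y)
      ≤ ((1 - ε) ^ α + ((Fintype.card ι : ℝ) - 1) ^ (1 - α) * ε ^ α) ^ (1 / α)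
        * ∑ y, powerNorm α (q y) := by
  have hne : Nonempty ι := by
    by_contra h
    rw [not_nonempty_iff] at h
    simp at hps
  have hd0 : 0 < (Fintype.card ι : ℝ) := by exact_mod_cast Fintype.card_pos
  set n := (Fintype.card ι : ℝ) - 1 with hn
  have hdn : (Fintype.card ι : ℝ) = n + 1 := by rw [hn]; ring
  have hn0 : 0 < n := by
    have : 1 / (Fintype.card ι : ℝ) < 1 := by linarith
    rw [div_lt_one hd0] at this
    linarith
  have hx0 : 0 < 1 - ε := by have : 0 < 1 / (Fintype.card ι : ℝ) := by positivity
                             linarith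
  -- The vector with one entry `1 - ε` and `n` entries `z` is the extremal one, and `C` below is its
  -- `powerNorm`.
  set z := ε / n with hz
  have hz0 : 0 < z := by positivity
  have hnz : n * z = ε := by rw [hz]; field_simp
  -- Here the upper limit on `ε` enters; it is what makes `N₁ ≤ N₂`.
  have hzx : z ≤ 1 - ε := by
    rw [hz, div_le_iff₀ hn0]
    rw [hdn] at hε'
    have : ε * (n + 1) ≤ (1 - 1 / (n + 1)) * (n + 1) := by gcongr
    rw [sub_mul, one_div_mul_cancel (by positivity)] at this
    linarith
  have hc : n ^ (1 - α) * ε ^ α = n * z ^ α := by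
    rw [← hnz, Real.mul_rpow hn0.le hz0.le, ← mul_assoc, ← Real.rpow_add hn0]
    simp
  rw [hc]
  set C := ((1 - ε) ^ α + n * z ^ α) ^ (1 / α) with hCdef
  have hC0 : 0 < C := by positivity
  have hCα : C ^ α = (1 - ε) ^ α + n * z ^ α := by
    rw [hCdef, ← Real.rpow_mul (by positivity), one_div_mul_cancel hα.ne', Real.rpow_one]
  set N₁ := C ^ (1 - α) * (1 - ε) ^ (α - 1) with hN₁
  set N₂ := C ^ (1 - α) * z ^ (α - 1) with hN₂
  have h1 : 0 ≤ N₁ := by positivity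
  have h12 : N₁ ≤ N₂ := mul_le_mul_of_nonneg_left
    (Real.rpow_le_rpow_of_nonpos hz0 hzx (by linarith)) (by positivity)
  -- Euler's identity for the homogeneous function of degree one. It exhibits `C` as a convex
  -- combination of `N₁` and `N₂`, so that `N₁ ≤ C`.
  have hval : N₁ * (1 - ε) + N₂ * ε = C := by
    have e1 : (1 - ε) ^ (α - 1) * (1 - ε) = (1 - ε) ^ α := by
      rw [Real.rpow_sub_one hx0.ne']; field_simp
    have e2 : z ^ (α - 1) * z = z ^ α := by
      rw [Real.rpow_sub_one hz0.ne']; field_simp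
    have e3 : C ^ (1 - α) * C ^ α = C := by
      rw [← Real.rpow_add hC0]; simp
    rw [hN₁, hN₂]
    linear_combination C ^ (1 - α) * e1 + C ^ (1 - α) * n * e2 - C ^ (1 - α) * hCα + e3
      - C ^ (1 - α) * z ^ (α - 1) * hnz
  have hNC : N₁ ≤ C := by nlinarith
  have hT : ∀ X R : ℝ, 0 ≤ X → 0 ≤ R →
      X ^ α + ((Fintype.card ι : ℝ) - 1) ^ (1 - α) * R ^ α ≤ (N₁ * X + N₂ * R) ^ α :=
    fun X R hX hR => rpow_add_rpow_le_tangent hα hα'.le hn0 hx0 hz0 hC0 hCα hX hR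
  have hsum := Finset.sum_le_sum fun y (_ : y ∈ Finset.univ) =>
    powerNorm_le_min hα hα'.le h1 h12 hNC hT (hp y) (hq y)
  simp only [Finset.sum_add_distrib, ← Finset.mul_sum, Finset.sum_sub_distrib] at hsum
  have hmin : ∀ y i, min (p y i) (q y i) = (p y i + q y i - |p y i - q y i|) / 2 := fun y i => by
    rcases le_total (p y i) (q y i) with h | h
    · rw [min_eq_left h, abs_of_nonpos (sub_nonpos.2 h)]; ring
    · rw [min_eq_right h, abs_of_nonneg (sub_nonneg.2 h)]; ring
  have hW : 1 - ε ≤ ∑ y, ∑ i, min (p y i) (q y i) := by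
    simp only [hmin, ← Finset.sum_div, Finset.sum_sub_distrib, Finset.sum_add_distrib]
    linarith
  rw [hps, hqs] at hsum
  -- With total overlap `W ≥ 1 - ε`, `N₁ * W + N₂ * (1 - W)` is at most its value `C` at `W = 1 -
  -- ε`, which cancels the `-C` coming from `∑ q = 1`.
  nlinarith [mul_le_mul_of_nonneg_left hW (sub_nonneg.2 h12)]

end PowerNorm

/-! ### Spectral decompositions -/

section Spectral

variable {n κ : Type*} [Fintype n] [DecidableEq n] [Fintype κ] [DecidableEq κ]

/-- The matrix `U diag(d) U†`. -/
noncomputable def conjDiag (U : Matrix n n ℂ) (d : n → ℝ) : Matrix n n ℂ :=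
  U * Matrix.diagonal (fun i => (d i : ℂ)) * U.conjTranspose

lemma conjDiag_one (d : n → ℝ) : conjDiag 1 d = Matrix.diagonal (fun i => (d i : ℂ)) := by
  simp [conjDiag]

lemma conjDiag_conjTranspose (U : Matrix n n ℂ) (d : n → ℝ) :
    (conjDiag U d).conjTranspose = conjDiag U d := by
  simp [conjDiag, Matrix.conjTranspose_mul, Matrix.diagonal_conjTranspose, Matrix.mul_assoc,
    Pi.star_def]

lemma conjDiag_mul {U : Matrix n n ℂ} (hU : U ∈ Matrix.unitaryGroup n ℂ) (d e : n → ℝ) :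
    conjDiag U d * conjDiag U e = conjDiag U (d * e) := by
  have h : U.conjTranspose * U = 1 := Matrix.mem_unitaryGroup_iff'.1 hU
  calc conjDiag U d * conjDiag U e
      = U * Matrix.diagonal (fun i => (d i : ℂ)) * (U.conjTranspose * U) *
        Matrix.diagonal (fun i => (e i : ℂ)) * U.conjTranspose := by
        simp only [conjDiag, Matrix.mul_assoc]
    _ = conjDiag U (d * e) := by
        rw [h, mul_one, Matrix.mul_assoc U, Matrix.diagonal_mul_diagonal, conjDiag]
        simp

lemma trace_conjDiag {U : Matrix n n ℂ} (hU : U ∈ Matrix.unitaryGroup n ℂ) (d : n → ℝ) :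
    (conjDiag U d).trace = ((∑ i, d i : ℝ) : ℂ) := by
  have h : U.conjTranspose * U = 1 := Matrix.mem_unitaryGroup_iff'.1 hU
  rw [conjDiag, Matrix.trace_mul_comm, ← Matrix.mul_assoc, h, one_mul, Matrix.trace_diagonal]
  push_cast
  rfl

lemma exists_conjDiag {M : Matrix n n ℂ} (hM : M.IsHermitian) :
    ∃ U ∈ Matrix.unitaryGroup n ℂ, M = conjDiag U hM.eigenvalues := by
  refine ⟨hM.eigenvectorUnitary, hM.eigenvectorUnitary.2, ?_⟩
  conv_lhs => rw [hM.spectral_theorem, Unitary.conjStarAlgAut_apply]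
  rfl

/-- The functional calculus can be evaluated in any diagonalization. -/
lemma cfc_conjDiag {U : Matrix n n ℂ} (hU : U ∈ Matrix.unitaryGroup n ℂ) (d : n → ℝ)
    (f : ℝ → ℝ) : cfc f (conjDiag U d) = conjDiag U (f ∘ d) := by
  have hM : (conjDiag U d).IsHermitian := conjDiag_conjTranspose U d
  set e := hM.eigenvalues with he
  set W : Matrix n n ℂ := (hM.eigenvectorUnitary : Matrix n n ℂ) with hW
  have hWU : W ∈ Matrix.unitaryGroup n ℂ := hM.eigenvectorUnitary.2
  have h1 : conjDiag U d = conjDiag W e := by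
    conv_lhs => rw [hM.spectral_theorem, Unitary.conjStarAlgAut_apply]
    rfl
  have h2 : cfc f (conjDiag U d) = conjDiag W (f ∘ e) := by
    rw [hM.cfc_eq, Matrix.IsHermitian.cfc, Unitary.conjStarAlgAut_apply]
    rfl
  have hUU : U.conjTranspose * U = 1 := Matrix.mem_unitaryGroup_iff'.1 hU
  have hUU' : U * U.conjTranspose = 1 := Matrix.mem_unitaryGroup_iff.1 hU
  have hWW : W.conjTranspose * W = 1 := Matrix.mem_unitaryGroup_iff'.1 hWU
  have hWW' : W * W.conjTranspose = 1 := Matrix.mem_unitaryGroup_iff.1 hWU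
  set V := U.conjTranspose * W with hV
  have h3 : Matrix.diagonal (fun i => (d i : ℂ)) * V
      = V * Matrix.diagonal (fun i => (e i : ℂ)) := by
    have h := congrArg (fun M => U.conjTranspose * M * W) h1
    simp only [conjDiag] at h
    calc Matrix.diagonal (fun i => (d i : ℂ)) * V
        = (U.conjTranspose * U) * Matrix.diagonal (fun i => (d i : ℂ)) * V := by
          rw [hUU, one_mul]
      _ = U.conjTranspose * (U * Matrix.diagonal (fun i => (d i : ℂ)) * U.conjTranspose) * W := by
          simp only [hV, Matrix.mul_assoc]
      _ = V * Matrix.diagonal (fun i => (e i : ℂ)) * (W.conjTranspose * W) := by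
          rw [h]; simp only [hV, Matrix.mul_assoc]
      _ = _ := by rw [hWW, mul_one]
  have h4 : Matrix.diagonal (fun i => ((f ∘ d) i : ℂ)) * V
      = V * Matrix.diagonal (fun i => ((f ∘ e) i : ℂ)) := by
    ext i j
    have h := congrFun (congrFun h3 i) j
    rw [Matrix.diagonal_mul, Matrix.mul_diagonal] at h ⊢
    by_cases hv : V i j = 0
    · simp [hv]
    -- A nonzero entry of the intertwiner `V` forces `d i = e j`, so `V` also intertwines the images
    -- under `f`.
    · rw [mul_comm (V i j)] at h ⊢
      have : d i = e j := by exact_mod_cast mul_right_cancel₀ hv h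
      simp [this]
  rw [h2]
  calc conjDiag W (f ∘ e) = (U * U.conjTranspose) * conjDiag W (f ∘ e) := by rw [hUU', one_mul]
    _ = U * (V * Matrix.diagonal (fun i => ((f ∘ e) i : ℂ))) * W.conjTranspose := by
        simp only [hV, conjDiag, Matrix.mul_assoc]
    _ = U * Matrix.diagonal (fun i => ((f ∘ d) i : ℂ)) * U.conjTranspose
          * (W * W.conjTranspose) := by
        rw [← h4]; simp only [hV, Matrix.mul_assoc]
    _ = conjDiag U (f ∘ d) := by rw [hWW', mul_one]; rfl

lemma blockDiagonal_mem_unitaryGroup {U : κ → Matrix n n ℂ}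
    (hU : ∀ y, U y ∈ Matrix.unitaryGroup n ℂ) :
    Matrix.blockDiagonal U ∈ Matrix.unitaryGroup (n × κ) ℂ := by
  rw [Matrix.mem_unitaryGroup_iff, Matrix.star_eq_conjTranspose,
    Matrix.blockDiagonal_conjTranspose, ← Matrix.blockDiagonal_mul,
    show (fun k => U k * (U k).conjTranspose) = 1 from
      funext fun k => Matrix.mem_unitaryGroup_iff.1 (hU k), Matrix.blockDiagonal_one]

lemma blockDiagonal_conjDiag (U : κ → Matrix n n ℂ) (d : κ → n → ℝ) :
    Matrix.blockDiagonal (fun y => conjDiag (U y) (d y))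
      = conjDiag (Matrix.blockDiagonal U) (fun i => d i.2 i.1) := by
  rw [conjDiag, Matrix.blockDiagonal_conjTranspose,
    ← Matrix.blockDiagonal_diagonal (fun y i => (d y i : ℂ)), ← Matrix.blockDiagonal_mul,
    ← Matrix.blockDiagonal_mul]
  rfl

lemma cfc_blockDiagonal {U : κ → Matrix n n ℂ} (hU : ∀ y, U y ∈ Matrix.unitaryGroup n ℂ)
    (d : κ → n → ℝ) (f : ℝ → ℝ) :
    cfc f (Matrix.blockDiagonal fun y => conjDiag (U y) (d y))
      = Matrix.blockDiagonal fun y => conjDiag (U y) (f ∘ d y) := by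
  rw [blockDiagonal_conjDiag, cfc_conjDiag (blockDiagonal_mem_unitaryGroup hU),
    blockDiagonal_conjDiag U fun y => f ∘ d y]
  rfl

lemma traceNorm_conjDiag {U : Matrix n n ℂ} (hU : U ∈ Matrix.unitaryGroup n ℂ) (d : n → ℝ) :
    traceNorm (conjDiag U d) = ∑ i, |d i| := by
  rw [traceNorm, conjDiag_conjTranspose, conjDiag_mul hU, cfc_conjDiag hU, trace_conjDiag hU,
    Complex.ofReal_re]
  exact Finset.sum_congr rfl fun i _ => by simp [Real.sqrt_mul_self_eq_abs]

/-! ### Diagonals in another eigenbasis -/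

lemma sum_normSq_row {V : Matrix n n ℂ} (hV : V ∈ Matrix.unitaryGroup n ℂ) (i : n) :
    ∑ j, Complex.normSq (V i j) = 1 := by
  have h := congrFun (congrFun (Matrix.mem_unitaryGroup_iff.1 hV) i) i
  rw [Matrix.mul_apply, Matrix.one_apply_eq] at h
  have h' : ∑ j, (Complex.normSq (V i j) : ℂ) = 1 := by
    rw [← h]
    exact Finset.sum_congr rfl fun j _ => by
      rw [Matrix.star_apply, Complex.normSq_eq_conj_mul_self, mul_comm]; rfl
  exact_mod_cast h'

lemma sum_normSq_col {V : Matrix n n ℂ} (hV : V ∈ Matrix.unitaryGroup n ℂ) (j : n) :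
    ∑ i, Complex.normSq (V i j) = 1 := by
  have h := sum_normSq_row (Unitary.star_mem hV) j
  simpa [Matrix.star_apply] using h

lemma conjDiag_diag_apply (V : Matrix n n ℂ) (d : n → ℝ) (i : n) :
    conjDiag V d i i = ((∑ j, Complex.normSq (V i j) * d j : ℝ) : ℂ) := by
  rw [conjDiag, Matrix.mul_apply]
  push_cast
  refine Finset.sum_congr rfl fun j _ => ?_
  rw [Matrix.mul_diagonal, Matrix.conjTranspose_apply, Complex.normSq_eq_conj_mul_self]
  change _ * _ * (starRingEnd ℂ) _ = _
  ring

lemma conjTranspose_mul_conjDiag_mul (W U : Matrix n n ℂ) (d : n → ℝ) :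
    W.conjTranspose * conjDiag U d * W = conjDiag (W.conjTranspose * U) d := by
  simp [conjDiag, Matrix.conjTranspose_mul, Matrix.mul_assoc]

/-- For Hermitian matrices `M` and `N` there is a vector `x`, the diagonal of `M` in an eigenbasis
of `N`, which is smoother than the spectrum of `M` and as close to the spectrum of `N` as the
matrices are. -/
lemma exists_pinching {U W V : Matrix n n ℂ} (hU : U ∈ Matrix.unitaryGroup n ℂ)
    (hW : W ∈ Matrix.unitaryGroup n ℂ) (hV : V ∈ Matrix.unitaryGroup n ℂ) {p q δ : n → ℝ}
    (hp : ∀ i, 0 ≤ p i) (h : conjDiag U p - conjDiag W q = conjDiag V δ) :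
    ∃ x : n → ℝ, (∀ i, 0 ≤ x i) ∧ ∑ i, x i = ∑ i, p i ∧ ∑ i, |x i - q i| ≤ ∑ i, |δ i| ∧
      ∀ α : ℝ, 0 < α → α ≤ 1 → ∑ i, p i ^ α ≤ ∑ i, x i ^ α := by
  have hWW : W.conjTranspose * W = 1 := Matrix.mem_unitaryGroup_iff'.1 hW
  set S := W.conjTranspose * U with hS
  have hSU : S ∈ Matrix.unitaryGroup n ℂ := mul_mem (Unitary.star_mem hW) hU
  set T := W.conjTranspose * V with hT
  have hTU : T ∈ Matrix.unitaryGroup n ℂ := mul_mem (Unitary.star_mem hW) hV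
  have hn := fun z : ℂ => Complex.normSq_nonneg z
  refine ⟨fun i => ∑ j, Complex.normSq (S i j) * p j,
    fun i => Finset.sum_nonneg fun j _ => mul_nonneg (hn _) (hp j), ?_, ?_, ?_⟩
  · rw [Finset.sum_comm]
    exact Finset.sum_congr rfl fun j _ => by rw [← Finset.sum_mul, sum_normSq_col hSU, one_mul]
  -- Compare diagonals of `h` in the eigenbasis `W`: there the second matrix is `diag q`, and the
  -- difference averages `δ` with doubly stochastic weights.
  · have hd : ∀ i, ∑ j, Complex.normSq (S i j) * p j - q i
        = ∑ j, Complex.normSq (T i j) * δ j := fun i => by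
      have h1 := congrArg (fun M => (W.conjTranspose * M * W) i i) h
      simp only [Matrix.mul_sub, Matrix.sub_mul, conjTranspose_mul_conjDiag_mul, hWW,
        Matrix.sub_apply, conjDiag_one, Matrix.diagonal_apply_eq] at h1
      rw [← hS, ← hT, conjDiag_diag_apply, conjDiag_diag_apply] at h1
      exact_mod_cast h1
    calc ∑ i, |∑ j, Complex.normSq (S i j) * p j - q i|
        ≤ ∑ i, ∑ j, Complex.normSq (T i j) * |δ j| := Finset.sum_le_sum fun i _ => by
          rw [hd]
          refine (Finset.abs_sum_le_sum_abs _ _).trans_eq ?_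
          exact Finset.sum_congr rfl fun j _ => by rw [abs_mul, abs_of_nonneg (hn _)]
      _ = ∑ j, |δ j| := by
          rw [Finset.sum_comm]
          exact Finset.sum_congr rfl fun j _ => by
            rw [← Finset.sum_mul, sum_normSq_col hTU, one_mul]
  · intro α hα hα'
    calc ∑ i, p i ^ α = ∑ i, ∑ j, Complex.normSq (S i j) * p j ^ α := by
          rw [Finset.sum_comm]
          exact Finset.sum_congr rfl fun j _ => by
            rw [← Finset.sum_mul, sum_normSq_col hSU, one_mul]
      _ ≤ _ := Finset.sum_le_sum fun i _ => by
          have := (Real.concaveOn_rpow hα.le hα').le_map_sum (t := Finset.univ)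
            (w := fun j => Complex.normSq (S i j)) (p := p) (fun j _ => hn _)
            (sum_normSq_row hSU i) fun j _ => hp j
          simpa using this

end Spectral

/-! ### Classical-quantum states -/

lemma partialTraceLeft_blockDiagonal {n κ : Type*} [Fintype n] [DecidableEq κ]
    (M : κ → Matrix n n ℂ) :
    partialTraceLeft (Matrix.blockDiagonal M) = Matrix.diagonal fun y => (M y).trace := by
  ext i j
  simp only [partialTraceLeft, Matrix.of_apply, Matrix.blockDiagonal_apply, Matrix.diagonal_apply]
  split_ifs <;> simp [Matrix.trace]

lemma sum_kronecker_single {A Y : Type*} [Fintype Y] [DecidableEq Y] (M : Y → Matrix A A ℂ) :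
    ∑ y, M y ⊗ₖ Matrix.single y y (1 : ℂ) = Matrix.blockDiagonal M := by
  ext ⟨a, i⟩ ⟨b, j⟩
  simp only [Matrix.sum_apply, Matrix.kroneckerMap_apply, Matrix.blockDiagonal_apply,
    Matrix.single_apply]
  rw [Finset.sum_eq_single i (fun y _ hy => by simp [hy]) (by simp)]
  simp

section CQ

variable {A Y : Type*} [Fintype A] [DecidableEq A] [Fintype Y] [DecidableEq Y]

/-- The spectral decomposition of a classical-quantum state. -/
structure IsCQSpectrum (ρ : Matrix (A × Y) (A × Y) ℂ) (U : Y → Matrix A A ℂ)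
    (d : Y → A → ℝ) : Prop where
  unitary : ∀ y, U y ∈ Matrix.unitaryGroup A ℂ
  nonneg : ∀ y a, 0 ≤ d y a
  sum_eq_one : ∑ y, ∑ a, d y a = 1
  eq : ρ = Matrix.blockDiagonal fun y => conjDiag (U y) (d y)

lemma IsCQState.exists_spectrum {ρ : Matrix (A × Y) (A × Y) ℂ} (h : IsCQState ρ) :
    ∃ U d, IsCQSpectrum ρ U d := by
  obtain ⟨r, τ, hr, hr1, hτ, rfl⟩ := h
  choose U hU hUτ using fun y => exists_conjDiag (hτ y).1.isHermitian
  have hs : ∀ y, ∑ a, (hτ y).1.isHermitian.eigenvalues a = 1 := fun y => by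
    have h := (hτ y).2
    rw [(hτ y).1.isHermitian.trace_eq_sum_eigenvalues] at h
    have h' := congrArg Complex.re h
    simpa using h'
  refine ⟨U, fun y a => r y * (hτ y).1.isHermitian.eigenvalues a, hU,
    fun y a => mul_nonneg (hr y) ((hτ y).1.eigenvalues_nonneg a), ?_, ?_⟩
  · simp [← Finset.mul_sum, hs, hr1]
  · rw [← sum_kronecker_single]
    refine Finset.sum_congr rfl fun y _ => ?_
    rw [← Matrix.smul_kronecker]
    congr 1
    conv_lhs => rw [hUτ y]
    rw [conjDiag, conjDiag, ← Matrix.smul_mul, ← Matrix.mul_smul, ← Matrix.diagonal_smul]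
    congr 3
    ext a
    simp

lemma isCQState_blockDiagonal_single [Nonempty A] (y₀ : Y) {d : A → ℝ} (hd : ∀ a, 0 ≤ d a)
    (hd1 : ∑ a, d a = 1) :
    IsCQState (Matrix.blockDiagonal fun y =>
      conjDiag (1 : Matrix A A ℂ) (fun a => if y = y₀ then d a else 0)) := by
  refine ⟨fun y => if y = y₀ then 1 else 0,
    fun _ => Matrix.diagonal fun a => (d a : ℂ), fun y => by dsimp only; split_ifs <;> simp, by simp,
    fun _ => ⟨Matrix.PosSemidef.diagonal fun a => Complex.zero_le_real.2 (hd a), ?_⟩, ?_⟩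
  · rw [Matrix.trace_diagonal]
    exact_mod_cast hd1
  · rw [← sum_kronecker_single]
    refine Finset.sum_congr rfl fun y _ => ?_
    rw [conjDiag_one]
    by_cases h : y = y₀ <;> simp [h]

variable {ρ σ : Matrix (A × Y) (A × Y) ℂ} {U W : Y → Matrix A A ℂ} {d e : Y → A → ℝ}

lemma IsCQSpectrum.partialTraceLeft_cfc (h : IsCQSpectrum ρ U d) (f : ℝ → ℝ) :
    partialTraceLeft (cfc f ρ)
      = conjDiag 1 (fun y => ∑ a, f (d y a)) := by
  rw [h.eq, cfc_blockDiagonal h.unitary, partialTraceLeft_blockDiagonal, conjDiag_one]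
  congr 1
  ext y
  rw [trace_conjDiag (h.unitary y)]
  rfl

lemma IsCQSpectrum.condRenyi_of_pos (h : IsCQSpectrum ρ U d) {α : ℝ} (hα : 0 < α) :
    condRenyi α ρ = α / (1 - α) * Real.log (∑ y, powerNorm α (d y)) := by
  have hf : ∀ s : ℝ, 0 < s → (fun x : ℝ => if x = 0 then 0 else x ^ s) = fun x => x ^ s :=
    fun s hs => by
      ext x
      split_ifs with hx
      · rw [hx, Real.zero_rpow hs.ne']
      · rfl
  rw [condRenyi, if_neg hα.ne', psdPow, psdPow, hf α hα, hf _ (one_div_pos.2 hα),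
    h.partialTraceLeft_cfc, cfc_conjDiag (one_mem _), trace_conjDiag (one_mem _),
    Complex.ofReal_re]
  rfl

lemma IsCQSpectrum.condRenyi_zero (h : IsCQSpectrum ρ U d) :
    condRenyi 0 ρ
      = Real.log (sSup (Set.range fun y => ((Finset.univ.filter fun a => d y a ≠ 0).card : ℝ))) := by
  have hsp : ∀ g : Y → ℝ, spectrum ℝ (conjDiag (1 : Matrix Y Y ℂ) g) = Set.range g := fun g => by
    ext x
    rw [conjDiag_one, ← spectrum.algebraMap_mem_iff ℂ, spectrum_diagonal]
    simp
  rw [condRenyi, if_pos rfl, psdPow, h.partialTraceLeft_cfc, hsp]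
  congr 3
  ext y
  rw [Finset.card_filter]
  push_cast
  refine Finset.sum_congr rfl fun a _ => ?_
  by_cases ha : d y a = 0 <;> simp [ha]

/-- The largest rank of a block lies between `1` and the dimension of `A`; this range alone settles
the bound at `α = 0`. -/
lemma IsCQSpectrum.condRenyi_zero_mem (h : IsCQSpectrum ρ U d) :
    0 ≤ condRenyi 0 ρ ∧ condRenyi 0 ρ ≤ Real.log (Fintype.card A) := by
  obtain ⟨y, a, ha⟩ : ∃ y a, d y a ≠ 0 := by
    by_contra! hne
    simpa [hne] using h.sum_eq_one
  have hbdd : BddAbove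
      (Set.range fun y => ((Finset.univ.filter fun a => d y a ≠ 0).card : ℝ)) :=
    (Set.finite_range _).bddAbove
  have h1 : (1 : ℝ) ≤
      sSup (Set.range fun y => ((Finset.univ.filter fun a => d y a ≠ 0).card : ℝ)) := by
    refine le_trans ?_ (le_csSup hbdd ⟨y, rfl⟩)
    have h1 : 0 < (Finset.univ.filter fun a => d y a ≠ 0).card :=
      Finset.card_pos.2 ⟨a, by simpa using ha⟩
    exact Nat.one_le_cast.2 h1
  rw [h.condRenyi_zero]
  refine ⟨Real.log_nonneg h1, Real.log_le_log (by linarith) (csSup_le ⟨_, y, rfl⟩ ?_)⟩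
  rintro _ ⟨y, rfl⟩
  exact Nat.cast_le.2 (Finset.card_le_univ _)

lemma IsCQSpectrum.sum_powerNorm_pos (h : IsCQSpectrum ρ U d) {α : ℝ} (hα : 0 < α)
    (hα' : α ≤ 1) : 0 < ∑ y, powerNorm α (d y) := by
  have := Finset.sum_le_sum fun y (_ : y ∈ Finset.univ) => sum_le_powerNorm hα hα' (h.nonneg y)
  rw [h.sum_eq_one] at this
  linarith

/-- The trace distance of two classical-quantum states dominates the total variation distance
between the spectrum of one and a smoothing of the spectrum of the other. -/
lemma IsCQSpectrum.exists_smoothing (hρ : IsCQSpectrum ρ U d) (hσ : IsCQSpectrum σ W e) :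
    ∃ x : Y → A → ℝ, (∀ y a, 0 ≤ x y a) ∧ ∑ y, ∑ a, x y a = 1 ∧
      ∑ y, ∑ a, |x y a - e y a| ≤ 2 * traceDist ρ σ ∧
      ∀ α : ℝ, 0 < α → α ≤ 1 → ∀ y, powerNorm α (d y) ≤ powerNorm α (x y) := by
  have hH : ∀ y, (conjDiag (U y) (d y) - conjDiag (W y) (e y)).IsHermitian := fun y => by
    rw [Matrix.IsHermitian, Matrix.conjTranspose_sub, conjDiag_conjTranspose,
      conjDiag_conjTranspose]
  choose V hV hVeq using fun y => exists_conjDiag (hH y)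
  choose x hx0 hxs hxd hxα using fun y =>
    exists_pinching (hρ.unitary y) (hσ.unitary y) (hV y) (hρ.nonneg y) (hVeq y)
  refine ⟨x, hx0, by simp [hxs, hρ.sum_eq_one], ?_, fun α hα hα' y => ?_⟩
  · have hsub : ρ - σ = Matrix.blockDiagonal fun y => conjDiag (V y) (hH y).eigenvalues := by
      rw [hρ.eq, hσ.eq, ← Matrix.blockDiagonal_sub]
      congr 1
      ext1 y
      exact hVeq y
    rw [traceDist, hsub, blockDiagonal_conjDiag V fun y => (hH y).eigenvalues,
      traceNorm_conjDiag (blockDiagonal_mem_unitaryGroup hV), Fintype.sum_prod_type_right]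
    have := Finset.sum_le_sum fun y (_ : y ∈ Finset.univ) => hxd y
    linarith
  · rw [powerNorm_le_iff hα (hρ.nonneg y) (powerNorm_nonneg (hx0 y)), powerNorm_rpow hα (hx0 y)]
    exact hxα y α hα hα'

lemma traceDist_comm (ρ σ : Matrix (A × Y) (A × Y) ℂ) : traceDist ρ σ = traceDist σ ρ := by
  rw [traceDist, traceDist, traceNorm, traceNorm, ← neg_sub σ ρ, Matrix.conjTranspose_neg,
    neg_mul_neg]

end CQ

/-! ### The continuity bound and its tightness -/

lemma one_le_card_sub_one_of_le {A : Type*} [Fintype A] [Nonempty A] {ε : ℝ} (hε : 0 < ε)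
    (hε' : ε ≤ 1 - 1 / (Fintype.card A : ℝ)) :   1 ≤ (Fintype.card A : ℝ) - 1 := by
  have h0 : 0 < (Fintype.card A : ℝ) := by exact_mod_cast Fintype.card_pos
  have h1 : 1 / (Fintype.card A : ℝ) < 1 := by linarith
  rw [div_lt_one h0] at h1
  have h2 : 1 < Fintype.card A := by exact_mod_cast h1
  have h3 : (2 : ℝ) ≤ Fintype.card A := by exact_mod_cast h2
  linarith

section Continuity

variable {A Y : Type*} [Fintype A] [DecidableEq A] [Fintype Y] [DecidableEq Y]

/-- Since `t ≤ t ^ α` on `(0, 1)`, strictly at `ε`, the sum exceeds `(1 - ε) + ε`. It makes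
`gammaBound` positive, so the quotient in the tightness claim is genuine. -/
lemma one_lt_rpow_add_rpow {α ε n : ℝ} (hα' : α < 1) (hε : 0 < ε) (hε' : ε < 1)
    (hn : 1 ≤ n) : 1 < (1 - ε) ^ α + n ^ (1 - α) * ε ^ α := by
  have h1 : 1 - ε ≤ (1 - ε) ^ α := by
    simpa using Real.rpow_le_rpow_of_exponent_ge (x := 1 - ε) (by linarith) (by linarith) hα'.le
  have h2 : ε < ε ^ α := by
    simpa using Real.rpow_lt_rpow_of_exponent_gt hε hε' hα'
  have h3 : 1 ≤ n ^ (1 - α) := Real.one_le_rpow hn (by linarith)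
  nlinarith

lemma gammaBound_pos {α ε : ℝ} {d : ℕ} (hα' : α < 1) (hε : 0 < ε) (hε' : ε < 1)
    (hd : 1 ≤ (d : ℝ) - 1) : 0 < gammaBound α ε d :=
  mul_pos (one_div_pos.2 (sub_pos.2 hα'))
    (Real.log_pos (one_lt_rpow_add_rpow hα' hε hε' hd))

lemma gammaBound_zero (ε : ℝ) (d : ℕ) : gammaBound 0 ε d = Real.log d := by
  simp [gammaBound]

lemma condRenyi_sub_le {α ε : ℝ} (hα : 0 < α) (hα' : α < 1) (hε : 0 < ε)
    (hε' : ε ≤ 1 - 1 / (Fintype.card A : ℝ)) [Nonempty A] {ρ σ : Matrix (A × Y) (A × Y) ℂ}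
    (hρ : IsCQState ρ) (hσ : IsCQState σ) (h : traceDist ρ σ ≤ ε) :
    condRenyi α ρ - condRenyi α σ ≤ gammaBound α ε (Fintype.card A) := by
  obtain ⟨U, d, hd⟩ := hρ.exists_spectrum
  obtain ⟨W, e, he⟩ := hσ.exists_spectrum
  obtain ⟨x, hx0, hx1, hxe, hxα⟩ := hd.exists_smoothing he
  have hn := one_le_card_sub_one_of_le hε hε'
  have hε1 : ε < 1 := by
    have : 0 < 1 / (Fintype.card A : ℝ) := by
      have h0 : 0 < (Fintype.card A : ℝ) := by linarith
      positivity
    linarith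
  have hc := one_lt_rpow_add_rpow hα' hε hε1 hn
  have hc0 := zero_lt_one.trans hc
  have hle := (Finset.sum_le_sum fun y (_ : y ∈ Finset.univ) => hxα α hα hα'.le y).trans
    (sum_powerNorm_le hα hα' hε hε' hx0 he.nonneg hx1 he.sum_eq_one (by linarith))
  have hdp := hd.sum_powerNorm_pos hα hα'.le
  have hep := he.sum_powerNorm_pos hα hα'.le
  have hlog := Real.log_le_log hdp hle
  rw [Real.log_mul (Real.rpow_pos_of_pos hc0 _).ne' hep.ne', Real.log_rpow hc0] at hlog
  rw [hd.condRenyi_of_pos hα, he.condRenyi_of_pos hα, ← mul_sub, gammaBound]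
  have h1 : 0 < 1 - α := sub_pos.2 hα'
  refine (mul_le_mul_of_nonneg_left (sub_le_iff_le_add.2 hlog) (by positivity)).trans_eq ?_
  field_simp

lemma abs_condRenyi_sub_le {α ε : ℝ} (hα : 0 ≤ α) (hα' : α < 1) (hε : 0 < ε)
    (hε' : ε ≤ 1 - 1 / (Fintype.card A : ℝ)) [Nonempty A] {ρ σ : Matrix (A × Y) (A × Y) ℂ}
    (hρ : IsCQState ρ) (hσ : IsCQState σ) (h : traceDist ρ σ ≤ ε) :
    |condRenyi α ρ - condRenyi α σ| ≤ gammaBound α ε (Fintype.card A) := by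
  rcases hα.eq_or_lt with rfl | hpos
  · obtain ⟨U, d, hd⟩ := hρ.exists_spectrum
    obtain ⟨W, e, he⟩ := hσ.exists_spectrum
    have h1 := hd.condRenyi_zero_mem
    have h2 := he.condRenyi_zero_mem
    rw [gammaBound_zero, abs_le]
    constructor <;> linarith
  · rw [abs_sub_le_iff]
    exact ⟨condRenyi_sub_le hpos hα' hε hε' hρ hσ h,
      condRenyi_sub_le hpos hα' hε hε' hσ hρ (by rwa [traceDist_comm])⟩

/-! ### Tightness: extremal states -/

/-- The state with the distribution `d` at the classical value `y₀`. -/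
noncomputable def diagState (y₀ : Y) (d : A → ℝ) : Matrix (A × Y) (A × Y) ℂ :=
  Matrix.blockDiagonal fun y => conjDiag 1 (fun a => if y = y₀ then d a else 0)

lemma isCQSpectrum_diagState (y₀ : Y) {d : A → ℝ} (hd : ∀ a, 0 ≤ d a) (hd1 : ∑ a, d a = 1) :
    IsCQSpectrum (diagState y₀ d) (fun _ => 1) fun y a => if y = y₀ then d a else 0 where
  unitary _ := one_mem _
  nonneg y a := by
    split_ifs
    exacts [hd a, le_rfl]
  sum_eq_one := by
    rw [Finset.sum_eq_single y₀ (fun y _ hy => by simp [hy]) (by simp)]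
    simpa using hd1
  eq := rfl

lemma traceDist_diagState (y₀ : Y) (d e : A → ℝ) :
    traceDist (diagState y₀ d) (diagState y₀ e) = 1 / 2 * ∑ a, |d a - e a| := by
  have h : diagState y₀ d - diagState y₀ e = Matrix.blockDiagonal fun y =>
      conjDiag (1 : Matrix A A ℂ) (fun a => if y = y₀ then d a - e a else 0) := by
    rw [diagState, diagState, ← Matrix.blockDiagonal_sub]
    congr 1
    ext1 y
    simp only [Pi.sub_apply, conjDiag_one, Matrix.diagonal_sub]
    congr 1
    ext a
    split_ifs <;> simp
  rw [traceDist, h, blockDiagonal_conjDiag (fun _ => 1) fun y a => if y = y₀ then d a - e a else 0,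
    traceNorm_conjDiag (blockDiagonal_mem_unitaryGroup fun _ => one_mem _),
    Fintype.sum_prod_type_right,
    Finset.sum_eq_single y₀ (fun y _ hy => by simp [hy]) (by simp)]
  simp

lemma condRenyi_diagState_of_pos (y₀ : Y) {d : A → ℝ} (hd : ∀ a, 0 ≤ d a) (hd1 : ∑ a, d a = 1)
    {α : ℝ} (hα : 0 < α) :
    condRenyi α (diagState y₀ d) = 1 / (1 - α) * Real.log (∑ a, d a ^ α) := by
  have hpos : 0 < ∑ a, d a ^ α := by
    obtain ⟨a, ha⟩ : ∃ a, d a ≠ 0 := by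
      by_contra! hne
      simp [hne] at hd1
    exact Finset.sum_pos' (fun a _ => Real.rpow_nonneg (hd a) _)
      ⟨a, Finset.mem_univ _, Real.rpow_pos_of_pos ((hd a).lt_of_ne' ha) _⟩
  rw [(isCQSpectrum_diagState y₀ hd hd1).condRenyi_of_pos hα, Finset.sum_eq_single y₀]
  · simp only [if_true, powerNorm]
    rw [Real.log_rpow hpos]
    field_simp
  · intro y _ hy
    simp [hy, powerNorm, Real.zero_rpow hα.ne', hα.ne']
  · simp

lemma condRenyi_zero_diagState (y₀ : Y) {d : A → ℝ} (hd : ∀ a, 0 ≤ d a) (hd1 : ∑ a, d a = 1) :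
    condRenyi 0 (diagState y₀ d) = Real.log (Finset.univ.filter fun a => d a ≠ 0).card := by
  rw [(isCQSpectrum_diagState y₀ hd hd1).condRenyi_zero]
  congr 1
  -- Blocks away from `y₀` vanish and have rank zero, so the maximum is attained at `y₀`.
  refine IsGreatest.csSup_eq ⟨⟨y₀, by simp⟩, ?_⟩
  rintro _ ⟨y, rfl⟩
  by_cases hy : y = y₀ <;> simp [hy]

lemma exists_condRenyi_sub_eq [Nonempty A] [Nonempty Y] {α ε : ℝ} (hα : 0 ≤ α) (hε : 0 < ε)
    (hε' : ε ≤ 1 - 1 / (Fintype.card A : ℝ)) :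
    ∃ ρ σ : Matrix (A × Y) (A × Y) ℂ, IsCQState ρ ∧ IsCQState σ ∧ traceDist ρ σ ≤ ε ∧
      condRenyi α ρ - condRenyi α σ = gammaBound α ε (Fintype.card A) := by
  obtain ⟨a₀⟩ := ‹Nonempty A›
  have : Nonempty A := ⟨a₀⟩
  obtain ⟨y₀⟩ := ‹Nonempty Y›
  have hn := one_le_card_sub_one_of_le hε hε'
  have hε1 : ε < 1 := by
    have : 0 < 1 / (Fintype.card A : ℝ) := by
      have h0 : 0 < (Fintype.card A : ℝ) := by linarith
      positivity
    linarith
  set n := (Fintype.card A : ℝ) - 1 with hndef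
  have hn0 : 0 < n := by linarith
  set z := ε / n with hz
  have hz0 : 0 < z := by positivity
  have hnz : n * z = ε := by rw [hz]; field_simp
  have hcard : (((Finset.univ.erase a₀).card : ℕ) : ℝ) = n := by
    rw [Finset.card_erase_of_mem (Finset.mem_univ _), Finset.card_univ,
      Nat.cast_sub Fintype.card_pos, Nat.cast_one]
  have hsum : ∀ (f : A → ℝ) (b c : ℝ), f a₀ = b → (∀ a, a ≠ a₀ → f a = c) →
      ∑ a, f a = b + n * c := fun f b c hb hc => by
    rw [← Finset.add_sum_erase _ _ (Finset.mem_univ a₀), hb,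
      Finset.sum_congr rfl fun a ha => hc a (Finset.ne_of_mem_erase ha), Finset.sum_const,
      nsmul_eq_mul, hcard]
  set x : A → ℝ := fun a => if a = a₀ then 1 - ε else z with hx
  set s : A → ℝ := fun a => if a = a₀ then 1 else 0 with hs
  have hx0 : ∀ a, 0 < x a := fun a => by
    simp only [hx]
    split_ifs
    exacts [sub_pos.2 hε1, hz0]
  have hs0 : ∀ a, 0 ≤ s a := fun a => by
    simp only [hs]
    split_ifs <;> norm_num
  have hx1 : ∑ a, x a = 1 := by
    rw [hsum x (1 - ε) z (by simp [hx]) fun a ha => by simp [hx, ha], hnz]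
    ring
  have hs1 : ∑ a, s a = 1 := by simp [hs]
  refine ⟨diagState y₀ x, diagState y₀ s,
    isCQState_blockDiagonal_single y₀ (fun a => (hx0 a).le) hx1,
    isCQState_blockDiagonal_single y₀ hs0 hs1, ?_, ?_⟩
  · rw [traceDist_diagState, hsum _ ε z (by simp [hx, hs, abs_of_pos hε])
      fun a ha => by simp [hx, hs, ha, abs_of_pos hz0], hnz]
    linarith
  -- At `α = 0` the entropies are `log (card A)`, as `x` has full support, and `log 1`. For `α > 0`
  -- the pure state again has entropy zero, and `x` gives `gammaBound` exactly.
  rcases hα.eq_or_lt with rfl | hpos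
  · rw [condRenyi_zero_diagState y₀ (fun a => (hx0 a).le) hx1,
      condRenyi_zero_diagState y₀ hs0 hs1, gammaBound_zero]
    simp [hs, fun a => (hx0 a).ne', Finset.filter_eq']
  · rw [condRenyi_diagState_of_pos y₀ (fun a => (hx0 a).le) hx1 hpos,
      condRenyi_diagState_of_pos y₀ hs0 hs1 hpos,
      hsum (fun a => s a ^ α) 1 0 (by simp [hs])
        fun a ha => by simp [hs, ha, Real.zero_rpow hpos.ne'],
      hsum (fun a => x a ^ α) ((1 - ε) ^ α) (z ^ α) (by simp [hx])
        fun a ha => by simp [hx, ha], gammaBound, ← hndef]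
    have hc : n ^ (1 - α) * ε ^ α = n * z ^ α := by
      rw [← hnz, Real.mul_rpow hn0.le hz0.le, ← mul_assoc, ← Real.rpow_add hn0]
      simp
    rw [hc]
    simp

end Continuity

end CQEntropy

theorem theorem2 {A Y : Type*} [Fintype A] [DecidableEq A] [Fintype Y] [DecidableEq Y]
    [Nonempty A] [Nonempty Y] (α ε : ℝ) (hα : 0 ≤ α ∧ α < 1)
    (hε : 0 < ε ∧ ε ≤ 1 - 1 / (Fintype.card A : ℝ)) :
    (∀ ρ σ : Matrix (A × Y) (A × Y) ℂ,
      CQEntropy.IsCQState ρ → CQEntropy.IsCQState σ → CQEntropy.traceDist ρ σ ≤ ε →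
        |CQEntropy.condRenyi α ρ - CQEntropy.condRenyi α σ|
          ≤ CQEntropy.gammaBound α ε (Fintype.card A)) ∧
    IsLUB {x : ℝ | ∃ ρ σ : Matrix (A × Y) (A × Y) ℂ,
        CQEntropy.IsCQState ρ ∧ CQEntropy.IsCQState σ ∧ CQEntropy.traceDist ρ σ ≤ ε ∧
          x = |CQEntropy.condRenyi α ρ - CQEntropy.condRenyi α σ|
            / CQEntropy.gammaBound α ε (Fintype.card A)} 1 := by
  have hε1 : ε < 1 := by
    have : 0 < 1 / (Fintype.card A : ℝ) :=
      one_div_pos.2 (by exact_mod_cast Fintype.card_pos)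
    linarith [hε.2]
  have hγ := CQEntropy.gammaBound_pos hα.2 hε.1 hε1
    (CQEntropy.one_le_card_sub_one_of_le hε.1 hε.2)
  refine ⟨fun ρ σ hρ hσ h =>
    CQEntropy.abs_condRenyi_sub_le hα.1 hα.2 hε.1 hε.2 hρ hσ h, IsGreatest.isLUB ⟨?_, ?_⟩⟩
  · obtain ⟨ρ, σ, hρ, hσ, h, heq⟩ :=
      CQEntropy.exists_condRenyi_sub_eq (A := A) (Y := Y) hα.1 hε.1 hε.2
    exact ⟨ρ, σ, hρ, hσ, h, by rw [heq, abs_of_pos hγ, div_self hγ.ne']⟩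
  · rintro _ ⟨ρ, σ, hρ, hσ, h, rfl⟩
    exact (div_le_one hγ).2 (CQEntropy.abs_condRenyi_sub_le hα.1 hα.2 hε.1 hε.2 hρ hσ h)
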